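/- **Theorem.** Let $G$ be the line $\mathbb R$ or the circle $\mathbb R/\mathbb Z$, with Lebesgue (Haar) measure, and let $\mathcal D$ be the space of test functions $\mathscr S(\mathbb R;\mathbb C)$ or $C^\infty(\mathbb R/\mathbb Z;\mathbb C)$, respectively, with dual space $\mathcal D'$ of distributions. All random distributions are random elements of $\mathcal D'$ with the $\sigma$-algebra generated by the evaluations $u\mapsto\langle u,\varphi\rangle$, $\varphi\in\mathcal D$, on one probability space $(\Omega,\mathbb P)$. A random distribution is *complex Gaussian* if each finite family of its evaluations has the law of $m+AY$, where $m$ is a complex vector, $A$ is a complex matrix, and $Y$ is a vector of independent circular complex Gaussian numbers with $\mathbb E|Y_i|^2=1$. Let $V=|\sigma_0|^2$ be an almost surely positive random variable with an arbitrary prior law, and let the scatterer $\mu$ be a random distribution whose conditional law given $V=v$ is that of an Itô measure with constant variance function $v$, i.e. of a complex Gaussian random distribution with mean zero and $\mathbb E[\langle\mu,\varphi\rangle\overline{\langle\mu,\psi\rangle}]=v\int_G\varphi\overline\psi\,dx$ for all $\varphi,\psi\in\mathcal D$. Consider two measurements $$z_1=\epsilon_1*\mu+\xi_1,\qquad z_2=\epsilon_2*\mu+\xi_2,$$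 where $z_1,z_2$ are random distributions; the noises $\xi_1,\xi_2$ are identically distributed complex Gaussian random distributions, each independent of the pair $(V,\mu)$; and the waveforms $\epsilon_j\in\mathcal D'$ are deterministic. In the case $G=\mathbb R$ it is assumed that the functions $r\mapsto\langle\epsilon_j,\varphi(\cdot+r)\rangle$ are in $L^2(\mathbb R)$ for all $\varphi\in\mathcal D$ (in the case of the circle this always holds). The convolution is the random distribution with $$\langle\epsilon_j*\mu,\varphi\rangle=\int_G\langle\epsilon_j,\varphi(\cdot+r)\rangle\,\mu(dr)\quad\text{almost surely, for each }\varphi\in\mathcal D,$$ where the Itô integral $\int f\,d\mu$ of $f\in L^2(G)$ is the limit in probability of $\langle\mu,\psi_n\rangle$ for $\psi_n\in\mathcal D$ with $\psi_n\to f$ in $L^2(G)$. Suppose that $|\widehat\epsilon_1|=|\widehat\epsilon_2|$. For $G=\mathbb R$ this means that the Fourier transforms $\widehat\epsilon_j$ are functions, integrable against every Schwartz function, whose moduli are equal as tempered distributions; for $G=\mathbb R/\mathbb Z$ it means that the Fourier coefficients satisfy $|\widehat\epsilon_1(n)|=|\widehat\epsilon_2(n)|$ for all $n\in\mathbb Z$.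 Then $z_1$ and $z_2$ have the same law, and the posterior variances of $|\sigma_0|^2$ given $z_1$ and given $z_2$ are equal: $$\mathrm{var}(|\sigma_0|^2\mid z_1=z)=\mathrm{var}(|\sigma_0|^2\mid z_2=z)$$ for almost every datum $z\in\mathcal D'$ with respect to this law. Here $\mathrm{var}(|\sigma_0|^2\mid z_j=z)\in[0,\infty]$ is the variance of the regular conditional distribution of $|\sigma_0|^2$ given $z_j=z$. -/

import Mathlib

open MeasureTheory ProbabilityTheory Filter
open scoped Topology ENNReal SchwartzMap FourierTransform ComplexConjugate

noncomputable section

namespace PulseCompression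

/-! ### Random distributions

`E` is a space of complex test functions on a measure space `G`, and `E →Lₚₜ[ℂ] ℂ` is the space of
distributions: the continuous linear functionals on `E`. -/

section Distributions

variable {E : Type*} [AddCommGroup E] [Module ℂ E] [TopologicalSpace E]

/-- The cylinder σ-algebra on a space of distributions: the smallest one for which every evaluation
`u ↦ u φ` at a test function is measurable. -/
instance distributionMeasurableSpace : MeasurableSpace (E →Lₚₜ[ℂ] ℂ) :=
  ⨆ φ : E, MeasurableSpace.comap (fun u : E →Lₚₜ[ℂ] ℂ => u φ) inferInstance

/-- The law of a standard circular complex Gaussian number `Y = a + i b`: `a` and `b` are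
independent and `N(0, 1/2)`, so that `𝔼|Y|² = 1`. -/
def stdComplexGaussian : Measure ℂ :=
  ((gaussianReal 0 (1 / 2)).prod (gaussianReal 0 (1 / 2))).map
    (fun p : ℝ × ℝ => (p.1 : ℂ) + (p.2 : ℂ) * Complex.I)

/-- The law of a complex Gaussian vector `X = m + A Y`, where `Y` is a vector of independent
standard complex Gaussian numbers (a discrete complex white noise). -/
def IsComplexGaussianVector {n : ℕ} (ν : Measure (Fin n → ℂ)) : Prop :=
  ∃ (k : ℕ) (m : Fin n → ℂ) (A : Matrix (Fin n) (Fin k) ℂ),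
    ν = (Measure.pi fun _ : Fin k => stdComplexGaussian).map (fun y => m + A.mulVec y)

/-- The law of a complex Gaussian random distribution: all finite families of evaluations at test
functions are complex Gaussian vectors. -/
def IsComplexGaussian (ν : Measure (E →Lₚₜ[ℂ] ℂ)) : Prop :=
  ∀ (n : ℕ) (φ : Fin n → E),
    IsComplexGaussianVector (ν.map fun (u : E →Lₚₜ[ℂ] ℂ) (i : Fin n) => u (φ i))

end Distributions

/-- The structure measure `X(B) = ∫_B v(x) dx` of a variance function `v = |σ|²`. -/
def structureMeasure {G : Type*} [MeasureSpace G] (v : G → ℝ) : Measure G :=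
  volume.withDensity fun x => ENNReal.ofReal (v x)

section Scattering

variable {G : Type*} [AddCommGroup G] [MeasureSpace G]
  {E : Type*} [FunLike E G ℂ] [AddCommGroup E] [Module ℂ E] [TopologicalSpace E]
  {Ω : Type*} [MeasurableSpace Ω]

/-- `ν` is the law of an Itô measure with structure measure `X`: a centred complex Gaussian random
distribution `μ` with `𝔼[μ(φ) conj μ(ψ)] = ∫ φ conj ψ dX`. -/
structure IsItoMeasure (X : Measure G) (ν : Measure (E →Lₚₜ[ℂ] ℂ)) : Prop where
  gaussian : IsComplexGaussian ν
  mean_zero : ∀ φ : E, ∫ u, u φ ∂ν = 0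
  covariance : ∀ φ ψ : E, ∫ u, u φ * conj (u ψ) ∂ν = ∫ x, φ x * conj (ψ x) ∂X

/-- The hierarchical scattering model with constant random variance: `V = σ₀² > 0` is a random
variable (its law is the prior), and the conditional law of `μ` given `V = v` is that of an Itô
measure with constant variance function `v`. -/
structure IsScatterer (P : Measure Ω) (V : Ω → ℝ) (μ : Ω → (E →Lₚₜ[ℂ] ℂ)) : Prop where
  measurable_variance : Measurable V
  pos : ∀ᵐ ω ∂P, 0 < V ω
  measurable_scatterer : Measurable μ
  condLaw : ∃ κ : Kernel ℝ (E →Lₚₜ[ℂ] ℂ), IsMarkovKernel κ ∧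
    P.map (fun ω => (V ω, μ ω)) = (P.map V) ⊗ₘ κ ∧
    ∀ᵐ v ∂(P.map V), IsItoMeasure (structureMeasure fun _ : G => v) (κ v)

/-- `Y = ∫ f dμ`, the Itô integral of `f ∈ L²(G)`: for test functions `ψₙ → f` in `L²(G)`, the random
numbers `μ(ψₙ)` converge to `Y` in probability. -/
def IsItoIntegral (P : Measure Ω) (μ : Ω → (E →Lₚₜ[ℂ] ℂ)) (f : G → ℂ) (Y : Ω → ℂ) : Prop :=
  ∃ ψ : ℕ → E,
    Tendsto (fun n => eLpNorm (fun x => ψ n x - f x) 2 volume) atTop (𝓝 0) ∧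
    TendstoInMeasure P (fun n ω => μ ω (ψ n)) atTop Y

/-- `f(r) = ⟨ε, φ(· + r)⟩`, which for a function `ε` is `∫ ε(t - r) φ(t) dt`: the transpose of
the convolution operator `η ↦ ε * η`, applied to the test function `φ`. -/
def IsConvTranspose (ε : E →Lₚₜ[ℂ] ℂ) (φ : E) (f : G → ℂ) : Prop :=
  ∀ r : G, ∃ χ : E, (∀ x, χ x = φ (x + r)) ∧ f r = ε χ

/-- `w = ε * μ` as random distributions: for every test function `φ`, almost surely
`⟨w, φ⟩ = ∫ ⟨ε, φ(· + r)⟩ μ(dr)`. If the transpose of convolution by `ε` maps test functions to test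
functions, the Itô integral on the right is `μ` evaluated at that test function, and this is the
usual convolution of two distributions. -/
def IsConvolution (P : Measure Ω) (ε : E →Lₚₜ[ℂ] ℂ) (μ w : Ω → (E →Lₚₜ[ℂ] ℂ)) : Prop :=
  ∀ φ : E, ∃ f : G → ℂ, IsConvTranspose ε φ f ∧ IsItoIntegral P μ f (fun ω => w ω φ)

/-- `z = ε * μ + ξ` with a complex Gaussian noise `ξ` that is independent of the scatterer. -/
structure IsMeasurement (P : Measure Ω) (V : Ω → ℝ) (μ : Ω → (E →Lₚₜ[ℂ] ℂ))
    (ε : E →Lₚₜ[ℂ] ℂ) (ξ z : Ω → (E →Lₚₜ[ℂ] ℂ)) : Prop where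
  measurable_noise : Measurable ξ
  measurable_signal : Measurable z
  gaussian_noise : IsComplexGaussian (P.map ξ)
  indep : IndepFun (fun ω => (V ω, μ ω)) ξ P
  signal : ∃ w : Ω → (E →Lₚₜ[ℂ] ℂ),
    IsConvolution (G := G) P ε μ w ∧ ∀ᵐ ω ∂P, z ω = w ω + ξ ω

end Scattering

/-- The posterior variance `var(V | z = d)`: the variance, in `[0, ∞]`, of the regular conditional
distribution of `V` given `z = d`. -/
def posteriorVariance {Ω D : Type*} [MeasurableSpace Ω] [MeasurableSpace D]
    (P : Measure Ω) [IsFiniteMeasure P] (V : Ω → ℝ) (z : Ω → D) (d : D) : ℝ≥0∞ :=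
  evariance id (condDistrib V z P d)

/-! ### Waveforms on the line -/

/-- The Fourier transform of the tempered distribution `ε` is the function `e`. -/
def HasFourierFunction (ε : 𝓢'(ℝ, ℂ)) (e : ℝ → ℂ) : Prop :=
  ∀ φ : 𝓢(ℝ, ℂ), Integrable (fun x => φ x * e x) ∧ (𝓕 ε) φ = ∫ x, φ x * e x

/-- The Fourier transforms of `ε₁` and `ε₂` are functions whose moduli coincide as tempered
distributions. -/
def SameFourierModulus (ε₁ ε₂ : 𝓢'(ℝ, ℂ)) : Prop :=
  ∃ e₁ e₂ : ℝ → ℂ, HasFourierFunction ε₁ e₁ ∧ HasFourierFunction ε₂ e₂ ∧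
    ∀ φ : 𝓢(ℝ, ℂ), ∫ x, φ x * (‖e₁ x‖ : ℂ) = ∫ x, φ x * (‖e₂ x‖ : ℂ)

/-! ### Test functions and distributions on the circle `ℝ / ℤ` -/

/-- The smooth functions on the circle, as a subspace of all functions. -/
def circleSmooth : Submodule ℂ (UnitAddCircle → ℂ) where
  carrier := {f | ContDiff ℝ (⊤ : ℕ∞) fun x : ℝ => f (x : UnitAddCircle)}
  add_mem' {f g} hf hg := by
    rw [Set.mem_ofPred_eq] at hf hg ⊢
    exact hf.add hg
  zero_mem' := by
    rw [Set.mem_ofPred_eq]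
    exact contDiff_const
  smul_mem' c f hf := by
    rw [Set.mem_ofPred_eq] at hf ⊢
    exact contDiff_const.mul hf

/-- The space `𝓓(𝕋)` of smooth complex functions on the circle. -/
def CircleTest : Type := circleSmooth

instance : AddCommGroup CircleTest := inferInstanceAs (AddCommGroup circleSmooth)

instance : Module ℂ CircleTest := inferInstanceAs (Module ℂ circleSmooth)

instance : FunLike CircleTest UnitAddCircle ℂ where
  coe f := f.1
  coe_injective := Subtype.val_injective

/-- Uniform convergence of the derivatives of all orders. -/
instance : TopologicalSpace CircleTest :=
  ⨅ k : ℕ, TopologicalSpace.induced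
    (fun f : CircleTest =>
      UniformFun.ofFun (iteratedDeriv k fun x : ℝ => f (x : UnitAddCircle))) inferInstance

/-- The character `t ↦ exp(2πint)` as a test function. -/
def circleChar (n : ℤ) : CircleTest :=
  ⟨fun t => fourier n t, by
    change ContDiff ℝ (⊤ : ℕ∞) fun x : ℝ => fourier n (x : UnitAddCircle)
    simp only [fourier_coe_apply]
    exact ((contDiff_const.mul Complex.ofRealCLM.contDiff).div_const _).cexp⟩

/-- The Fourier coefficient `ε̂(n) = ⟨ε, exp(-2πint)⟩` of a distribution on the circle. -/
def circleFourier (ε : CircleTest →Lₚₜ[ℂ] ℂ) (n : ℤ) : ℂ := ε (circleChar (-n))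

end PulseCompression

end

namespace PulseCompression

/-! ### Complex Gaussian vectors -/

/-! Everything about `z` that matters is in the joint law of `(z, V)`, and this law is determined by
the functionals `𝔼[1_{V ∈ A} exp(i Re ⟨z, φ⟩)]`. Given `V = v`, an evaluation of `μ` at `ψ` is a
centred circular Gaussian number of variance `v ‖ψ‖²`, so its real part has variance `v ‖ψ‖² / 2`
and contributes `exp(-v ‖ψ‖² / 4)`. Approximating in `L²` gives the same formula for `⟨ε * μ, φ⟩`,
with `ψ` replaced by `f(r) = ⟨ε, φ(· + r)⟩`; the independent noise contributes a factor that is the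
same for both measurements (`IsMeasurement.setIntegral_exp_re`).

Hence the waveform enters only through `‖f‖` in `L²`. Since `f` arises from `φ` by a Fourier
multiplier given by the transform of `ε`, Plancherel (on the line) or Parseval (on the circle)
expresses `‖f‖` through the modulus of that transform alone. So `(z₁, V)` and `(z₂, V)` have the
same law, and equality of the laws of the data and of the posteriors follows
(`law_and_posteriorVariance_eq`). -/

instance : IsProbabilityMeasure stdComplexGaussian := by
  unfold stdComplexGaussian
  exact Measure.isProbabilityMeasure_map (by fun_prop)

theorem charFun_stdComplexGaussian (t : ℂ) :
    charFun stdComplexGaussian t = Complex.exp (-(‖t‖ ^ 2 / 4 : ℝ)) := by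
  have h : charFun stdComplexGaussian t =
      charFun (gaussianReal 0 (1 / 2)) t.re * charFun (gaussianReal 0 (1 / 2)) t.im := by
    rw [charFun_apply, stdComplexGaussian, integral_map (by fun_prop) (by fun_prop),
      charFun_apply, charFun_apply, ← integral_prod_mul]
    refine integral_congr_ae (ae_of_all _ fun p => ?_)
    simp only [← Complex.exp_add]
    congr 1
    simp [Complex.inner]
    ring
  rw [h, charFun_gaussianReal, charFun_gaussianReal, ← Complex.exp_add]
  congr 1
  rw [Complex.sq_norm, Complex.normSq_apply]
  push_cast
  simp
  ring

theorem memLp_id_stdComplexGaussian : MemLp (fun y : ℂ => y) 2 stdComplexGaussian := by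
  rw [stdComplexGaussian, memLp_map_measure_iff (by fun_prop) (by fun_prop)]
  have h := memLp_id_gaussianReal (μ := 0) (v := 1 / 2) 2
  have h1 : MemLp (fun p : ℝ × ℝ => p.1) 2
      ((gaussianReal 0 (1 / 2)).prod (gaussianReal 0 (1 / 2))) := h.comp_fst _
  have h2 : MemLp (fun p : ℝ × ℝ => p.2) 2
      ((gaussianReal 0 (1 / 2)).prod (gaussianReal 0 (1 / 2))) := h.comp_snd _
  have h1' : MemLp (fun p : ℝ × ℝ => (p.1 : ℂ)) 2
      ((gaussianReal 0 (1 / 2)).prod (gaussianReal 0 (1 / 2))) := h1.ofReal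
  have h2' : MemLp (fun p : ℝ × ℝ => (p.2 : ℂ) * Complex.I) 2
      ((gaussianReal 0 (1 / 2)).prod (gaussianReal 0 (1 / 2))) :=
    MemLp.mul_const (f := fun p : ℝ × ℝ => (p.2 : ℂ)) h2.ofReal _
  exact MemLp.add h1' h2'

theorem integral_id_stdComplexGaussian : ∫ y, y ∂stdComplexGaussian = 0 := by
  have h := (memLp_id_gaussianReal (μ := 0) (v := 1 / 2) 1).integrable le_rfl
  rw [stdComplexGaussian, integral_map (by fun_prop) (by fun_prop), integral_add,
    integral_mul_const]
  · rw [integral_complex_ofReal, integral_complex_ofReal]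
    have h1 := integral_fun_fst (μ := gaussianReal 0 (1 / 2)) (ν := gaussianReal 0 (1 / 2))
      (fun x : ℝ => x)
    have h2 := integral_fun_snd (μ := gaussianReal 0 (1 / 2)) (ν := gaussianReal 0 (1 / 2))
      (fun x : ℝ => x)
    rw [h1, h2]
    simp
  · exact (h.comp_fst _).ofReal
  · exact (h.comp_snd _).ofReal.mul_const _

theorem integral_sq_gaussianReal_zero (v : NNReal) : ∫ x, x ^ 2 ∂(gaussianReal 0 v) = v := by
  have h := variance_eq_integral (X := id) (μ := gaussianReal 0 v) aemeasurable_id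
  rw [variance_id_gaussianReal] at h
  simpa using h.symm

theorem integral_norm_sq_stdComplexGaussian : ∫ y, ‖y‖ ^ 2 ∂stdComplexGaussian = 1 := by
  have h : Integrable (fun x : ℝ => x ^ 2) (gaussianReal 0 (1 / 2)) :=
    (memLp_id_gaussianReal (μ := 0) (v := 1 / 2) 2).integrable_sq
  rw [stdComplexGaussian, integral_map (by fun_prop) (by fun_prop)]
  have : ∀ p : ℝ × ℝ, ‖(p.1 : ℂ) + p.2 * Complex.I‖ ^ 2 = p.1 ^ 2 + p.2 ^ 2 := fun p => by
    rw [Complex.sq_norm, Complex.normSq_add_mul_I]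
  simp only [this]
  rw [integral_add (h.comp_fst _) (h.comp_snd _)]
  have h1 := integral_fun_fst (μ := gaussianReal 0 (1 / 2)) (ν := gaussianReal 0 (1 / 2))
      (fun x : ℝ => x ^ 2)
  have h2 := integral_fun_snd (μ := gaussianReal 0 (1 / 2)) (ν := gaussianReal 0 (1 / 2))
      (fun x : ℝ => x ^ 2)
  rw [h1, h2, integral_sq_gaussianReal_zero]
  simp
  norm_num

/-- A complex Gaussian number has the law of `m + s Y` with `s ≥ 0` and `Y` standard. -/
theorem IsComplexGaussianVector.exists_map_eq {ν : Measure (Fin 1 → ℂ)}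
    (hν : IsComplexGaussianVector ν) : ∃ (m : ℂ) (s : ℝ),
      ν.map (fun x => x 0) = stdComplexGaussian.map (fun y => m + s * y) := by
  obtain ⟨k, m, A, rfl⟩ := hν
  -- By circular symmetry the law of `a Y` depends only on `‖a‖`, and variances of independent
  -- summands add; so `s` is the Euclidean norm of the row.
  refine ⟨m 0, √(∑ j, ‖A 0 j‖ ^ 2), ?_⟩
  have hA : Measurable fun y : Fin k → ℂ => m + A.mulVec y :=
    (measurable_const.add (Continuous.measurable (by fun_prop)))
  rw [Measure.map_map (by fun_prop) hA]
  have : IsProbabilityMeasure ((Measure.pi fun _ : Fin k => stdComplexGaussian).map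
      ((fun x : Fin 1 → ℂ => x 0) ∘ fun y => m + A.mulVec y)) :=
    Measure.isProbabilityMeasure_map ((measurable_pi_apply 0).comp hA).aemeasurable
  have : IsProbabilityMeasure (stdComplexGaussian.map
      (fun y => m 0 + (√(∑ j, ‖A 0 j‖ ^ 2) : ℝ) * y)) :=
    Measure.isProbabilityMeasure_map (by fun_prop)
  refine Measure.ext_of_charFun (funext fun t => ?_)
  have key : ∀ a : ℂ, ∫ y, Complex.exp ((inner ℝ (a * y) t : ℝ) * Complex.I) ∂stdComplexGaussian =
      Complex.exp (-((‖a‖ ^ 2 * ‖t‖ ^ 2 / 4 : ℝ))) := fun a => by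
    have := charFun_stdComplexGaussian (conj a * t)
    rw [norm_mul, RCLike.norm_conj, mul_pow] at this
    rw [← this, charFun_apply]
    refine integral_congr_ae (ae_of_all _ fun y => ?_)
    simp only [Complex.inner, map_mul]
    congr 4
    ring
  rw [charFun_apply, charFun_apply, integral_map ((measurable_pi_apply 0).comp hA).aemeasurable (by fun_prop),
    integral_map (by fun_prop) (by fun_prop)]
  simp only [Function.comp_apply, Pi.add_apply, Matrix.mulVec, dotProduct, inner_add_left,
    Complex.ofReal_add, add_mul, Complex.exp_add, sum_inner, Complex.ofReal_sum, Finset.sum_mul,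
    Complex.exp_sum]
  rw [integral_const_mul, integral_const_mul, key,
    integral_fintype_prod_eq_prod (𝕜 := ℂ) (E := fun _ : Fin k => ℂ) (μ := fun _ => stdComplexGaussian)
      (fun j y => Complex.exp ((inner ℝ (A 0 j * y) t : ℝ) * Complex.I))]
  simp only [key, ← Complex.exp_sum]
  congr 2
  rw [Complex.norm_real, Real.norm_eq_abs, sq_abs, Real.sq_sqrt (by positivity)]
  push_cast
  rw [Finset.sum_neg_distrib, Finset.sum_mul, Finset.sum_div]

section Distributions

variable {E : Type*} [AddCommGroup E] [Module ℂ E] [TopologicalSpace E]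

theorem measurable_eval (φ : E) : Measurable fun u : E →Lₚₜ[ℂ] ℂ => u φ :=
  Measurable.mono (comap_measurable _) (le_iSup (fun φ : E => MeasurableSpace.comap
    (fun u : E →Lₚₜ[ℂ] ℂ => u φ) inferInstance) φ) le_rfl

/-- The characteristic function of an evaluation of a centred complex Gaussian distribution. -/
theorem IsComplexGaussian.integral_exp_re {ν : Measure (E →Lₚₜ[ℂ] ℂ)}
    (hν : IsComplexGaussian ν) (φ : E) (h0 : ∫ u, u φ ∂ν = 0) :
    ∫ u, Complex.exp ((u φ).re * Complex.I) ∂ν =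
      Complex.exp (-((∫ u, ‖u φ‖ ^ 2 ∂ν) / 4 : ℝ)) := by
  obtain ⟨m, s, h⟩ := (hν 1 fun _ => φ).exists_map_eq
  have hφ := measurable_eval φ
  rw [Measure.map_map (by fun_prop) (measurable_pi_lambda _ fun _ => hφ)] at h
  change ν.map (fun u => u φ) = _ at h
  have hint : ∀ F : ℂ → ℂ, Measurable F →
      ∫ u, F (u φ) ∂ν = ∫ y, F (m + s * y) ∂stdComplexGaussian := fun F hF => by
    rw [← integral_map (f := F) hφ.aemeasurable hF.aestronglyMeasurable, h,
      integral_map (by fun_prop) hF.aestronglyMeasurable]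
  have hi := memLp_id_stdComplexGaussian.integrable one_le_two
  have hm : m = 0 := by
    have := hint id measurable_id
    simp only [id] at this
    rw [h0, integral_add (integrable_const _) (hi.const_mul _), integral_const_mul,
      integral_id_stdComplexGaussian] at this
    simpa using this.symm
  subst hm
  have h2 : ∫ u, ‖u φ‖ ^ 2 ∂ν = s ^ 2 := by
    rw [← integral_map (f := fun z : ℂ => ‖z‖ ^ 2) hφ.aemeasurable (by fun_prop), h,
      integral_map (by fun_prop) (by fun_prop)]
    simp [mul_pow, integral_const_mul, integral_norm_sq_stdComplexGaussian]
  rw [h2, hint (fun z => Complex.exp (z.re * Complex.I)) (by fun_prop)]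
  have := charFun_stdComplexGaussian (s : ℂ)
  rw [Complex.norm_real, Real.norm_eq_abs, sq_abs] at this
  rw [← this, charFun_apply]
  refine integral_congr_ae (ae_of_all _ fun y => ?_)
  simp [Complex.inner]

end Distributions

/-! ### Laws of random distributions -/

theorem measurable_exp_re : Measurable fun y : ℂ => Complex.exp (y.re * Complex.I) := by
  fun_prop

section Distributions

variable {E : Type*} [AddCommGroup E] [Module ℂ E] [TopologicalSpace E]

/-- A finite measure on distributions is determined by its characteristic functional. -/
theorem ext_of_charFunctional {ν₁ ν₂ : Measure (E →Lₚₜ[ℂ] ℂ)} [IsFiniteMeasure ν₁]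
    [IsFiniteMeasure ν₂]
    (h : ∀ φ : E, ∫ u, Complex.exp ((u φ).re * Complex.I) ∂ν₁ =
      ∫ u, Complex.exp ((u φ).re * Complex.I) ∂ν₂) : ν₁ = ν₂ := by
  classical
  let c : (E →Lₚₜ[ℂ] ℂ) → E → ℂ := fun u φ => u φ
  have hc : Measurable c := measurable_pi_lambda _ measurable_eval
  have hmap : ν₁.map c = ν₂.map c := by
    -- On the product `E → ℂ`, a finite measure is determined by its finite-dimensional marginals.
    have hlim : IsProjectiveLimit (ν₁.map c) (fun I => (ν₂.map c).map I.restrict) := by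
      intro I
      have hI : Measurable (I.restrict (π := fun _ : E => ℂ)) := by fun_prop
      change _ = (ν₂.map c).map I.restrict
      rw [Measure.map_map hI hc, Measure.map_map hI hc]
      refine Measure.ext_of_charFunDual (funext fun L => ?_)
      -- Every real-linear functional of finitely many complex numbers is `Re ∑ aᵢ zᵢ`, and complex
      -- linearity of `u` gathers the sum into one evaluation. This is why real parts of single
      -- evaluations suffice.
      have hL : ∃ φ : E, ∀ u : E →Lₚₜ[ℂ] ℂ, L (I.restrict (c u)) = (u φ).re := by
        choose a ha using fun i : I => show ∃ a : ℂ, ∀ z : ℂ,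
            L (Pi.single i z) = (a * z).re from by
          refine ⟨⟨L (Pi.single i 1), -L (Pi.single i Complex.I)⟩, fun z => ?_⟩
          have : (Pi.single i z : I → ℂ) =
              z.re • (Pi.single i 1 : I → ℂ) + z.im • (Pi.single i Complex.I : I → ℂ) := by
            rw [← Pi.single_smul, ← Pi.single_smul, ← Pi.single_add]
            congr 1
            simp [Complex.re_add_im]
          rw [this, map_add, map_smul, map_smul]
          simp
          ring
        refine ⟨∑ i : I, a i • (i : E), fun u => ?_⟩
        have : I.restrict (c u) = ∑ i : I, Pi.single i (u i) := by
          rw [Finset.univ_sum_single]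
          rfl
        rw [this, map_sum, map_sum, Complex.re_sum]
        refine Finset.sum_congr rfl fun i _ => ?_
        rw [ha, map_smul, smul_eq_mul]
      obtain ⟨φ, hφ⟩ := hL
      rw [charFunDual_apply, charFunDual_apply,
        integral_map (hI.comp hc).aemeasurable (by fun_prop),
        integral_map (hI.comp hc).aemeasurable (by fun_prop)]
      simpa only [Function.comp_apply, hφ] using h φ
    exact hlim.unique fun I => rfl
  ext s hs
  -- Every measurable set is a preimage under `c`, so equality of the images under `c` gives
  -- equality of the measures.
  have hcomap : (distributionMeasurableSpace : MeasurableSpace (E →Lₚₜ[ℂ] ℂ)) =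
      MeasurableSpace.comap c MeasurableSpace.pi := by
    rw [distributionMeasurableSpace, MeasurableSpace.pi, MeasurableSpace.comap_iSup]
    simp only [MeasurableSpace.comap_comp]
    rfl
  rw [hcomap] at hs
  obtain ⟨t, ht, rfl⟩ := hs
  rw [← Measure.map_apply hc ht, ← Measure.map_apply hc ht, hmap]

end Distributions

/-- The joint law determines both its marginal and, almost everywhere, its disintegration. -/
theorem posteriorVariance_ae_eq {Ω D : Type*} [MeasurableSpace Ω] [MeasurableSpace D]
    (P : Measure Ω) [IsFiniteMeasure P] {V : Ω → ℝ} {z₁ z₂ : Ω → D} (hV : Measurable V)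
    (hz₁ : Measurable z₁) (hz₂ : Measurable z₂)
    (h : P.map (fun ω => (z₁ ω, V ω)) = P.map (fun ω => (z₂ ω, V ω))) :
    P.map z₁ = P.map z₂ ∧ posteriorVariance P V z₁ =ᵐ[P.map z₁] posteriorVariance P V z₂ := by
  have hz : P.map z₁ = P.map z₂ := by
    have := congrArg (Measure.map Prod.fst) h
    rwa [Measure.map_map measurable_fst (by fun_prop),
      Measure.map_map measurable_fst (by fun_prop)] at this
  refine ⟨hz, ?_⟩
  have : condDistrib V z₁ P =ᵐ[P.map z₁] condDistrib V z₂ P := by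
    rw [condDistrib_ae_eq_iff_measure_eq_compProd _ hV.aemeasurable, h, hz,
      compProd_map_condDistrib hV.aemeasurable]
  filter_upwards [this] with d hd
  rw [posteriorVariance, posteriorVariance, hd]

/-! ### Characteristic functionals of the scatterer and of the measurements -/

section Scattering

variable {G : Type*} [MeasureSpace G]
  {E : Type*} [FunLike E G ℂ] [AddCommGroup E] [Module ℂ E] [TopologicalSpace E]
  {Ω : Type*} [MeasurableSpace Ω] {P : Measure Ω} {V : Ω → ℝ} {μ ξ z : Ω → (E →Lₚₜ[ℂ] ℂ)}

theorem IsItoMeasure.integral_exp_re {v : ℝ} (hv : 0 ≤ v) {ν : Measure (E →Lₚₜ[ℂ] ℂ)}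
    (hν : IsItoMeasure (structureMeasure fun _ : G => v) ν) (ψ : E) :
    ∫ u, Complex.exp ((u ψ).re * Complex.I) ∂ν =
      Complex.exp (-(v * (∫ x : G, ‖ψ x‖ ^ 2) / 4 : ℝ)) := by
  have h : ∫ u : E →Lₚₜ[ℂ] ℂ, ‖u ψ‖ ^ 2 ∂ν = v * ∫ x : G, ‖ψ x‖ ^ 2 := by
    have := hν.covariance ψ ψ
    simp only [Complex.mul_conj, structureMeasure, withDensity_const, integral_smul_measure,
      Complex.normSq_eq_norm_sq, integral_complex_ofReal, ENNReal.toReal_ofReal hv] at this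
    rw [Complex.real_smul] at this
    exact_mod_cast this
  rw [hν.gaussian.integral_exp_re ψ (hν.mean_zero ψ), h]

/-- Disintegrate the law of `(V, μ)` over `V` and insert the Itô formula on each fibre. Keeping the
event `V ∈ A` retains the joint law with `V`. -/
theorem IsScatterer.setIntegral_exp_re [IsProbabilityMeasure P] (hS : IsScatterer (G := G) P V μ)
    (ψ : E) {A : Set ℝ} (hA : MeasurableSet A) :
    ∫ ω in V ⁻¹' A, Complex.exp ((μ ω ψ).re * Complex.I) ∂P =
      ∫ ω in V ⁻¹' A, Complex.exp (-(V ω * (∫ x : G, ‖ψ x‖ ^ 2) / 4 : ℝ)) ∂P := by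
  obtain ⟨κ, hκ, hP, hI⟩ := hS.condLaw
  have hV := hS.measurable_variance
  have hψ := measurable_eval ψ
  have hVμ : Measurable fun ω => (V ω, μ ω) := hV.prodMk hS.measurable_scatterer
  have hm : Measurable fun p : ℝ × (E →Lₚₜ[ℂ] ℂ) => Complex.exp ((p.2 ψ).re * Complex.I) := by
    exact measurable_exp_re.comp (hψ.comp measurable_snd)
  have hpos : ∀ᵐ v ∂(P.map V), 0 < v := by
    rw [ae_map_iff hV.aemeasurable measurableSet_Ioi]
    exact hS.pos
  have : IsProbabilityMeasure (P.map V) := Measure.isProbabilityMeasure_map hV.aemeasurable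
  have h1 := setIntegral_map (μ := P) (hA.prod (MeasurableSet.univ (α := E →Lₚₜ[ℂ] ℂ)))
    hm.aestronglyMeasurable hVμ.aemeasurable
  have h2 := setIntegral_map (μ := P) (f := fun v : ℝ =>
    Complex.exp (-(v * (∫ x : G, ‖ψ x‖ ^ 2) / 4 : ℝ))) hA
    (Continuous.aestronglyMeasurable (by fun_prop)) hV.aemeasurable
  have hpre : (fun ω => (V ω, μ ω)) ⁻¹' (A ×ˢ Set.univ) = V ⁻¹' A := by
    ext ω
    simp
  rw [hpre] at h1
  rw [← h1, ← h2, hP, Measure.setIntegral_compProd hA MeasurableSet.univ]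
  · refine integral_congr_ae (ae_restrict_of_ae ?_)
    filter_upwards [hI, hpos] with v hv hv0
    rw [Measure.restrict_univ, hv.integral_exp_re hv0.le]
  · refine (Integrable.of_bound (C := 1) hm.aestronglyMeasurable (ae_of_all _ fun p => ?_)).integrableOn
    rw [Complex.norm_exp_ofReal_mul_I]

theorem IsScatterer.setIntegral_exp_re_mul [IsProbabilityMeasure P]
    (hS : IsScatterer (G := G) P V μ) (hξ : Measurable ξ)
    (hind : IndepFun (fun ω => (V ω, μ ω)) ξ P)
    (ψ φ : E) {A : Set ℝ} (hA : MeasurableSet A) :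
    ∫ ω in V ⁻¹' A, Complex.exp ((μ ω ψ).re * Complex.I) *
        Complex.exp ((ξ ω φ).re * Complex.I) ∂P =
      (∫ ω in V ⁻¹' A, Complex.exp (-(V ω * (∫ x : G, ‖ψ x‖ ^ 2) / 4 : ℝ)) ∂P) *
        ∫ ω, Complex.exp ((ξ ω φ).re * Complex.I) ∂P := by
  have hV := hS.measurable_variance
  rw [← hS.setIntegral_exp_re ψ hA, ← integral_indicator (hV hA), ← integral_indicator (hV hA)]
  -- The indicator of `V ∈ A` is absorbed into the function of `(V, μ)`, as the noise is independent
  -- of the pair.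
  have h := hind.integral_fun_comp_mul_comp (𝕜 := ℂ)
    (f := (Prod.fst ⁻¹' A).indicator
      fun p : ℝ × (E →Lₚₜ[ℂ] ℂ) => Complex.exp ((p.2 ψ).re * Complex.I))
    (g := fun u : E →Lₚₜ[ℂ] ℂ => Complex.exp ((u φ).re * Complex.I))
    (hV.prodMk hS.measurable_scatterer).aemeasurable hξ.aemeasurable
    (Measurable.aestronglyMeasurable (Measurable.indicator
      (measurable_exp_re.comp ((measurable_eval ψ).comp measurable_snd)) (measurable_fst hA)))
    (measurable_exp_re.comp (measurable_eval φ)).aestronglyMeasurable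
  refine Eq.trans (integral_congr_ae (ae_of_all _ fun ω => ?_)) (h.trans (congrArg (· * _)
    (integral_congr_ae (ae_of_all _ fun ω => ?_))))
  · by_cases hω : V ω ∈ A <;> simp [Set.indicator, hω]
  · by_cases hω : V ω ∈ A <;> simp [Set.indicator, hω]

theorem integral_norm_sq_eq {f : G → ℂ} (hf : MemLp f 2 volume) :
    ∫ x, ‖f x‖ ^ 2 = (eLpNorm f 2 volume).toReal ^ 2 := by
  have h0 : 0 ≤ ∫ x, ‖f x‖ ^ 2 := integral_nonneg fun x => by positivity
  rw [hf.eLpNorm_eq_integral_rpow_norm (by simp) (by simp)]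
  simp only [ENNReal.toReal_ofNat, Real.rpow_two]
  rw [ENNReal.toReal_ofReal (by positivity), ← Real.rpow_natCast, ← Real.rpow_mul h0]
  simp

/-- The existence of the Itô integral thus already forces `f` to be square integrable, once `f` is
measurable. -/
theorem memLp_of_tendsto_eLpNorm {f : G → ℂ} (hf : AEStronglyMeasurable f volume)
    {ψ : ℕ → G → ℂ} (hψ : ∀ n, MemLp (ψ n) 2 volume)
    (h : Tendsto (fun n => eLpNorm (fun x => ψ n x - f x) 2 volume) atTop (𝓝 0)) :
    MemLp f 2 volume := by
  obtain ⟨n, hn⟩ := (h.eventually (gt_mem_nhds one_pos)).exists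
  have h1 : MemLp (fun x => ψ n x - f x) 2 volume :=
    ⟨(hψ n).aestronglyMeasurable.sub hf, hn.trans ENNReal.one_lt_top⟩
  have := (hψ n).sub h1
  simpa [Pi.sub_def] using this

theorem tendsto_toReal_eLpNorm {f : G → ℂ} (hf : AEStronglyMeasurable f volume)
    {ψ : ℕ → G → ℂ} (hψ : ∀ n, MemLp (ψ n) 2 volume)
    (h : Tendsto (fun n => eLpNorm (fun x => ψ n x - f x) 2 volume) atTop (𝓝 0)) :
    Tendsto (fun n => (eLpNorm (ψ n) 2 volume).toReal) atTop
      (𝓝 (eLpNorm f 2 volume).toReal) := by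
  have hfm := memLp_of_tendsto_eLpNorm hf hψ h
  have hr := (ENNReal.tendsto_toReal ENNReal.zero_ne_top).comp h
  rw [tendsto_iff_dist_tendsto_zero]
  refine squeeze_zero (fun _ => dist_nonneg) (fun n => ?_) hr
  have e : ∀ {g : G → ℂ} (hg : MemLp g 2 volume), (eLpNorm g 2 volume).toReal = ‖hg.toLp g‖ :=
    fun hg => (Lp.norm_toLp _ hg).symm
  have hd : MemLp (ψ n - f) 2 volume := (hψ n).sub hfm
  have : (eLpNorm (fun x => ψ n x - f x) 2 volume).toReal = ‖hd.toLp‖ := e hd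
  simp only [Function.comp_apply]
  rw [this, e (hψ n), e hfm, MemLp.toLp_sub (hψ n) hfm, Real.dist_eq]
  exact abs_norm_sub_norm_le _ _

variable [AddCommGroup G]

/-- The joint characteristic functional of the variance and the measurement. -/
theorem IsMeasurement.setIntegral_exp_re [IsProbabilityMeasure P]
    (hE : ∀ ψ : E, MemLp (fun x => ψ x) 2 (volume : Measure G))
    (hS : IsScatterer (G := G) P V μ) {ε : E →Lₚₜ[ℂ] ℂ} (hM : IsMeasurement (G := G) P V μ ε ξ z)
    (hε : ∀ (φ : E) (f : G → ℂ), IsConvTranspose ε φ f → AEStronglyMeasurable f volume) (φ : E) :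
    ∃ f : G → ℂ, IsConvTranspose ε φ f ∧ MemLp f 2 volume ∧ ∀ A : Set ℝ, MeasurableSet A →
      ∫ ω in V ⁻¹' A, Complex.exp ((z ω φ).re * Complex.I) ∂P =
      (∫ ω in V ⁻¹' A, Complex.exp (-(V ω * (eLpNorm f 2 volume).toReal ^ 2 / 4 : ℝ)) ∂P) *
        ∫ ω, Complex.exp ((ξ ω φ).re * Complex.I) ∂P := by
  obtain ⟨w, hw, hz⟩ := hM.signal
  obtain ⟨f, hf, ψ, hψ, hY⟩ := hw φ
  have hfm := hε φ f hf
  refine ⟨f, hf, memLp_of_tendsto_eLpNorm hfm (fun n => hE (ψ n)) hψ, fun A hA => ?_⟩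
  -- Convergence in probability gives almost sure convergence along a subsequence; dominated
  -- convergence then applies on both sides of the identity for test functions.
  obtain ⟨ns, hns, hae⟩ := hY.exists_seq_tendsto_ae
  have hV := hS.measurable_variance
  have hμψ : ∀ ψ : E, Measurable fun ω => μ ω ψ := fun ψ =>
    (measurable_eval ψ).comp hS.measurable_scatterer
  have hξφ : Measurable fun ω => ξ ω φ := (measurable_eval φ).comp hM.measurable_noise
  have hN := (tendsto_toReal_eLpNorm hfm (fun n => hE (ψ n)) hψ).comp hns.tendsto_atTop
  have lhs : Tendsto (fun n => ∫ ω in V ⁻¹' A, Complex.exp ((μ ω (ψ (ns n))).re * Complex.I) *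
        Complex.exp ((ξ ω φ).re * Complex.I) ∂P) atTop
      (𝓝 (∫ ω in V ⁻¹' A, Complex.exp ((z ω φ).re * Complex.I) ∂P)) := by
    refine tendsto_integral_of_dominated_convergence (fun _ => 1) (fun n => ?_)
      (integrable_const _) (fun n => ae_of_all _ fun ω => ?_) (ae_restrict_of_ae ?_)
    · have := hμψ (ψ (ns n))
      exact Measurable.aestronglyMeasurable (by fun_prop)
    · rw [norm_mul, Complex.norm_exp_ofReal_mul_I, Complex.norm_exp_ofReal_mul_I, one_mul]
    · filter_upwards [hae, hz] with ω hω hzω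
      have : Complex.exp ((z ω φ).re * Complex.I) = Complex.exp ((w ω φ).re * Complex.I) *
          Complex.exp ((ξ ω φ).re * Complex.I) := by
        rw [hzω, ← Complex.exp_add, ← add_mul]
        simp
      rw [this]
      refine Tendsto.mul_const _ ?_
      exact ((Continuous.tendsto (f := fun y : ℂ => Complex.exp (y.re * Complex.I))
        (by fun_prop) _).comp hω)
  have rhs : Tendsto (fun n => ∫ ω in V ⁻¹' A,
        Complex.exp (-(V ω * (eLpNorm (ψ (ns n)) 2 (volume : Measure G)).toReal ^ 2 / 4 : ℝ)) ∂P)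
      atTop (𝓝 (∫ ω in V ⁻¹' A,
        Complex.exp (-(V ω * (eLpNorm f 2 volume).toReal ^ 2 / 4 : ℝ)) ∂P)) := by
    refine tendsto_integral_of_dominated_convergence (fun _ => 1) (fun n => ?_)
      (integrable_const _) (fun n => ae_restrict_of_ae ?_) (ae_of_all _ fun ω => ?_)
    · exact Measurable.aestronglyMeasurable (by fun_prop)
    · filter_upwards [hS.pos] with ω hω
      rw [← Complex.ofReal_neg, Complex.norm_exp_ofReal, Real.exp_le_one_iff, neg_nonpos]
      positivity
    · exact ((Continuous.tendsto (f := fun y : ℝ => Complex.exp (-(V ω * y ^ 2 / 4 : ℝ)))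
        (by fun_prop) _).comp hN)
  refine tendsto_nhds_unique lhs ((rhs.mul_const _).congr fun n => ?_)
  rw [hS.setIntegral_exp_re_mul hM.measurable_noise hM.indep _ _ hA,
    integral_norm_sq_eq (hE (ψ (ns n)))]

/-- Two measurements agree in law, jointly with the variance, if the transposes of the convolutions
by their waveforms have the same `L²` norms. -/
theorem law_and_posteriorVariance_eq [IsProbabilityMeasure P]
    {ξ₁ ξ₂ z₁ z₂ : Ω → (E →Lₚₜ[ℂ] ℂ)} {ε₁ ε₂ : E →Lₚₜ[ℂ] ℂ}
    (hE : ∀ ψ : E, MemLp (fun x => ψ x) 2 (volume : Measure G))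
    (hS : IsScatterer (G := G) P V μ)
    (hM₁ : IsMeasurement (G := G) P V μ ε₁ ξ₁ z₁) (hM₂ : IsMeasurement (G := G) P V μ ε₂ ξ₂ z₂)
    (hξ : P.map ξ₁ = P.map ξ₂)
    (hε₁ : ∀ (φ : E) (f : G → ℂ), IsConvTranspose ε₁ φ f → AEStronglyMeasurable f volume)
    (hε₂ : ∀ (φ : E) (f : G → ℂ), IsConvTranspose ε₂ φ f → AEStronglyMeasurable f volume)
    (hnorm : ∀ (φ : E) (f₁ f₂ : G → ℂ), IsConvTranspose ε₁ φ f₁ → IsConvTranspose ε₂ φ f₂ →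
      MemLp f₁ 2 volume → MemLp f₂ 2 volume → eLpNorm f₁ 2 volume = eLpNorm f₂ 2 volume) :
    P.map z₁ = P.map z₂ ∧
      posteriorVariance P V z₁ =ᵐ[P.map z₁] posteriorVariance P V z₂ := by
  have hV := hS.measurable_variance
  have hz₁ := hM₁.measurable_signal
  have hz₂ := hM₂.measurable_signal
  refine posteriorVariance_ae_eq P hV hz₁ hz₂ (Measure.ext_prod fun {s A} hs hA => ?_)
  -- Restricting to `V ∈ A` reduces the joint law to finite measures on distributions alone.
  have key : (P.restrict (V ⁻¹' A)).map z₁ = (P.restrict (V ⁻¹' A)).map z₂ := by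
    refine ext_of_charFunctional fun φ => ?_
    have hm : Measurable fun u : E →Lₚₜ[ℂ] ℂ => Complex.exp ((u φ).re * Complex.I) :=
      measurable_exp_re.comp (measurable_eval φ)
    rw [integral_map hz₁.aemeasurable hm.aestronglyMeasurable,
      integral_map hz₂.aemeasurable hm.aestronglyMeasurable]
    obtain ⟨f₁, hf₁, hL₁, h₁⟩ := hM₁.setIntegral_exp_re hE hS hε₁ φ
    obtain ⟨f₂, hf₂, hL₂, h₂⟩ := hM₂.setIntegral_exp_re hE hS hε₂ φ
    rw [h₁ A hA, h₂ A hA, hnorm φ f₁ f₂ hf₁ hf₂ hL₁ hL₂,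
      ← integral_map hM₁.measurable_noise.aemeasurable hm.aestronglyMeasurable, hξ,
      integral_map hM₂.measurable_noise.aemeasurable hm.aestronglyMeasurable]
  have := congrArg (fun ν => ν s) key
  simp only [Measure.map_apply hz₁ hs, Measure.map_apply hz₂ hs,
    Measure.restrict_apply (hz₁ hs), Measure.restrict_apply (hz₂ hs)] at this
  rw [Measure.map_apply (hz₁.prodMk hV) (hs.prod hA), Measure.map_apply (hz₂.prodMk hV) (hs.prod hA)]
  exact this

end Scattering

/-! ### The line -/

/-- **Plancherel's theorem** for an integrable function with a square integrable Fourier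
transform. -/
theorem eLpNorm_fourier_eq {h : ℝ → ℂ} (hh : Integrable h) (h2 : MemLp (𝓕 h) 2 volume) :
    eLpNorm (𝓕 h) 2 volume = eLpNorm h 2 volume := by
  set F : Lp (α := ℝ) ℂ 2 volume := h2.toLp with hF
  -- The `L²` inverse transform of `𝓕 h` is identified with `h` by duality: `e1` moves `𝓕⁻` to the
  -- test function, `e3` moves the `L¹` transform off `h`, and `e4` cancels the two.
  have hae : ((𝓕⁻ F : Lp (α := ℝ) ℂ 2 volume) : ℝ → ℂ) =ᵐ[volume] h := by
    refine ae_eq_of_integral_contDiff_smul_eq ((Lp.memLp _).locallyIntegrable one_le_two)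
      hh.locallyIntegrable fun g hg hgc => ?_
    have hg₁ : HasCompactSupport (Complex.ofRealCLM ∘ g) := hgc.comp_left rfl
    have hg₂ : ContDiff ℝ (⊤ : ℕ∞) (Complex.ofRealCLM ∘ g) := by fun_prop
    set G : 𝓢(ℝ, ℂ) := hg₁.toSchwartzMap hg₂
    have hG : ∀ x, G x = g x := fun x => rfl
    have e1 : (Lp.toTemperedDistribution (𝓕⁻ F : Lp (α := ℝ) ℂ 2 volume)) G =
        Lp.toTemperedDistribution F (𝓕⁻ G) := by
      rw [← Lp.fourierInv_toTemperedDistribution_eq, TemperedDistribution.fourierInv_apply]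
    rw [Lp.toTemperedDistribution_apply, Lp.toTemperedDistribution_apply] at e1
    have e2 : ∫ x, (𝓕⁻ G) x • F x = ∫ x, (𝓕⁻ G) x • 𝓕 h x := by
      refine integral_congr_ae ?_
      filter_upwards [h2.coeFn_toLp] with x hx
      rw [hF, hx]
    have e3 : ∫ x, 𝓕 ((𝓕⁻ G : 𝓢(ℝ, ℂ)) : ℝ → ℂ) x • h x = ∫ x, (𝓕⁻ G) x • 𝓕 h x := by
      have := VectorFourier.integral_fourierIntegral_smul_eq_flip (L := innerₗ ℝ) (μ := volume)
        (ν := volume) Real.continuous_fourierChar (by exact continuous_inner)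
        (𝓕⁻ G).integrable hh
      exact this.trans (by rw [flip_innerₗ]; rfl)
    have e4 : 𝓕 ((𝓕⁻ G : 𝓢(ℝ, ℂ)) : ℝ → ℂ) = G := by
      rw [← SchwartzMap.fourier_coe, FourierTransform.fourier_fourierInv_eq]
    rw [e2, ← e3, e4] at e1
    simpa [hG] using e1
  have hn : ‖(𝓕⁻ F : Lp (α := ℝ) ℂ 2 volume)‖ = ‖F‖ := by
    rw [← Lp.norm_fourier_eq, FourierTransform.fourier_fourierInv_eq]
  rw [← eLpNorm_congr_ae hae, ← eLpNorm_congr_ae h2.coeFn_toLp]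
  rw [Lp.norm_def, Lp.norm_def, ENNReal.toReal_eq_toReal_iff' (Lp.eLpNorm_ne_top _)
    (Lp.eLpNorm_ne_top _)] at hn
  exact hn.symm

theorem HasFourierFunction.apply_eq {ε : 𝓢'(ℝ, ℂ)} {e : ℝ → ℂ} (h : HasFourierFunction ε e)
    (φ : 𝓢(ℝ, ℂ)) : ε φ = ∫ x, (𝓕⁻ φ) x * e x := by
  rw [← (h (𝓕⁻ φ)).2, TemperedDistribution.fourier_apply, FourierTransform.fourier_fourierInv_eq]

/-- The transpose of the convolution operator is a Fourier multiplier. -/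
theorem IsConvTranspose.eq_fourier {ε : 𝓢'(ℝ, ℂ)} {e : ℝ → ℂ} (h : HasFourierFunction ε e)
    {φ : 𝓢(ℝ, ℂ)} {f : ℝ → ℂ} (hf : IsConvTranspose ε φ f) :
    f = 𝓕 (fun x => (𝓕⁻ φ) x * e x) := by
  ext r
  obtain ⟨χ, hχ, hr⟩ := hf r
  rw [hr, h.apply_eq, Real.fourier_real_eq]
  refine integral_congr_ae (ae_of_all _ fun x => ?_)
  -- Translation of the test function becomes modulation, which supplies the kernel of the outer
  -- transform.
  have : (𝓕⁻ χ) x = Real.fourierChar (-(x * r)) • (𝓕⁻ φ) x := by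
    have hχ' : (χ : ℝ → ℂ) = φ ∘ fun v => v + r := funext hχ
    rw [SchwartzMap.fourierInv_coe, SchwartzMap.fourierInv_coe, Real.fourierInv_eq_fourier_neg,
      Real.fourierInv_eq_fourier_neg, hχ']
    have := congrFun (VectorFourier.fourierIntegral_comp_add_right Real.fourierChar volume
      (innerₗ ℝ) φ r) (-x)
    simpa [mul_comm] using! this
  simp only [this, smul_mul_assoc]

theorem HasFourierFunction.locallyIntegrable_norm {ε : 𝓢'(ℝ, ℂ)} {e : ℝ → ℂ}
    (h : HasFourierFunction ε e) : LocallyIntegrable fun x => (‖e x‖ : ℂ) := by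
  intro x
  -- The product `b e` is integrable and equals `e` on the unit ball, where `b = 1`.
  let b : ContDiffBump x := ⟨1, 2, one_pos, one_lt_two⟩
  have hb₁ : HasCompactSupport (Complex.ofRealCLM ∘ b) := b.hasCompactSupport.comp_left rfl
  have hb₂ : ContDiff ℝ (⊤ : ℕ∞) (Complex.ofRealCLM ∘ b) :=
    Complex.ofRealCLM.contDiff.comp b.contDiff
  have hi := (h (hb₁.toSchwartzMap hb₂)).1
  have he : IntegrableOn e (Metric.closedBall x 1) := by
    refine hi.integrableOn.congr_fun (fun y hy => ?_) measurableSet_closedBall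
    change (b y : ℂ) * e y = e y
    rw [b.one_of_mem_closedBall hy]
    simp
  exact ⟨_, Metric.closedBall_mem_nhds x one_pos, he.norm.ofReal⟩

theorem SameFourierModulus.eLpNorm_eq {ε₁ ε₂ : 𝓢'(ℝ, ℂ)} (h : SameFourierModulus ε₁ ε₂)
    {φ : 𝓢(ℝ, ℂ)} {f₁ f₂ : ℝ → ℂ} (hf₁ : IsConvTranspose ε₁ φ f₁) (hf₂ : IsConvTranspose ε₂ φ f₂)
    (h₁ : MemLp f₁ 2 volume) (h₂ : MemLp f₂ 2 volume) :
    eLpNorm f₁ 2 volume = eLpNorm f₂ 2 volume := by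
  obtain ⟨e₁, e₂, he₁, he₂, he⟩ := h
  have hae : (fun x => (‖e₁ x‖ : ℂ)) =ᵐ[volume] fun x => (‖e₂ x‖ : ℂ) := by
    refine ae_eq_of_integral_contDiff_smul_eq
      he₁.locallyIntegrable_norm he₂.locallyIntegrable_norm
      fun g hg hgc => ?_
    have hg₁ : HasCompactSupport (Complex.ofRealCLM ∘ g) := hgc.comp_left rfl
    have hg₂ : ContDiff ℝ (⊤ : ℕ∞) (Complex.ofRealCLM ∘ g) := by fun_prop
    simpa using he (hg₁.toSchwartzMap hg₂)
  have e₁' := hf₁.eq_fourier he₁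
  have e₂' := hf₂.eq_fourier he₂
  subst e₁' e₂'
  rw [eLpNorm_fourier_eq (he₁ _).1 h₁, eLpNorm_fourier_eq (he₂ _).1 h₂]
  refine eLpNorm_congr_norm_ae ?_
  filter_upwards [hae] with x hx
  rw [norm_mul, norm_mul, Complex.ofReal_injective hx]

theorem IsConvTranspose.continuous_of_hasFourierFunction {ε : 𝓢'(ℝ, ℂ)} {e : ℝ → ℂ}
    (h : HasFourierFunction ε e) {φ : 𝓢(ℝ, ℂ)} {f : ℝ → ℂ} (hf : IsConvTranspose ε φ f) :
    Continuous f := by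
  rw [hf.eq_fourier h]
  exact VectorFourier.fourierIntegral_continuous Real.continuous_fourierChar
    (by exact continuous_inner) (h (𝓕⁻ φ)).1

/-! ### The circle -/

namespace CircleTest

theorem contDiff (φ : CircleTest) : ContDiff ℝ (⊤ : ℕ∞) fun x : ℝ => φ (x : UnitAddCircle) :=
  φ.2

theorem continuous (φ : CircleTest) : Continuous φ := by
  have h : Continuous fun x : ℝ => φ (x : UnitAddCircle) := φ.contDiff.continuous
  exact (isQuotientMap_quotient_mk'.continuous_iff (g := φ)).2 h

theorem memLp (φ : CircleTest) : MemLp φ 2 (volume : Measure UnitAddCircle) := by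
  obtain ⟨C, hC⟩ := (isCompact_range φ.continuous).isBounded.exists_norm_le
  exact MemLp.of_bound φ.continuous.aestronglyMeasurable C
    (ae_of_all _ fun x => hC _ (Set.mem_range_self x))

theorem add_apply (φ ψ : CircleTest) (x : UnitAddCircle) : (φ + ψ) x = φ x + ψ x := rfl

theorem smul_apply (c : ℂ) (φ : CircleTest) (x : UnitAddCircle) : (c • φ) x = c * φ x := rfl

/-- Evaluation at a point of the circle. -/
def evalₗ (x : UnitAddCircle) : CircleTest →ₗ[ℂ] ℂ where
  toFun φ := φ x
  map_add' _ _ := rfl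
  map_smul' _ _ := rfl

theorem sum_apply {ι : Type*} (s : Finset ι) (φ : ι → CircleTest) (x : UnitAddCircle) :
    (∑ i ∈ s, φ i) x = ∑ i ∈ s, φ i x :=
  map_sum (evalₗ x) φ s

theorem ext_real {φ ψ : CircleTest} (h : ∀ x : ℝ, φ (x : UnitAddCircle) = ψ (x : UnitAddCircle)) :
    φ = ψ := by
  refine DFunLike.ext _ _ fun x => ?_
  induction x using QuotientAddGroup.induction_on with
  | H x => exact h x

theorem exists_derivative (φ : CircleTest) : ∃ ψ : CircleTest,
    ∀ x : ℝ, ψ (x : UnitAddCircle) = deriv (fun y : ℝ => φ (y : UnitAddCircle)) x := by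
  have hper : Function.Periodic (deriv fun y : ℝ => φ (y : UnitAddCircle)) 1 := by
    intro x
    rw [← deriv_comp_add_const]
    congr 1
    ext y
    rw [AddCircle.coe_add, AddCircle.coe_period, add_zero]
  -- The derivative of a periodic function is periodic, so it descends to the circle.
  refine ⟨⟨hper.lift, ?_⟩, fun x => rfl⟩
  change ContDiff ℝ (⊤ : ℕ∞) (deriv fun y : ℝ => φ (y : UnitAddCircle))
  exact (contDiff_infty_iff_deriv.1 φ.contDiff).2

/-- Differentiation of test functions. -/
noncomputable def derivₗ : CircleTest →ₗ[ℂ] CircleTest where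
  toFun φ := φ.exists_derivative.choose
  map_add' φ ψ := ext_real fun x => by
    rw [add_apply, φ.exists_derivative.choose_spec, ψ.exists_derivative.choose_spec,
      (φ + ψ).exists_derivative.choose_spec]
    exact deriv_add (φ.contDiff.differentiable (by simp) x) (ψ.contDiff.differentiable (by simp) x)
  map_smul' c φ := ext_real fun x => by
    rw [RingHom.id_apply, smul_apply, φ.exists_derivative.choose_spec,
      (c • φ).exists_derivative.choose_spec]
    exact deriv_const_mul c (φ.contDiff.differentiable (by simp) x)

theorem derivₗ_apply (φ : CircleTest) (x : ℝ) :
    derivₗ φ (x : UnitAddCircle) = deriv (fun y : ℝ => φ (y : UnitAddCircle)) x :=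
  φ.exists_derivative.choose_spec x

theorem iteratedDeriv_eq (φ : CircleTest) (k : ℕ) :
    iteratedDeriv k (fun x : ℝ => φ (x : UnitAddCircle)) =
      fun x : ℝ => (derivₗ ^ k) φ (x : UnitAddCircle) := by
  induction k with
  | zero => simp
  | succ k ih =>
    ext x
    rw [iteratedDeriv_succ, ih, pow_succ', Module.End.mul_apply, derivₗ_apply]

theorem derivₗ_circleChar (n : ℤ) :
    derivₗ (circleChar n) = (2 * Real.pi * Complex.I * n) • circleChar n := by
  refine ext_real fun x => ?_
  rw [derivₗ_apply, smul_apply]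
  have := (hasDerivAt_fourier 1 n x).deriv
  rw [Complex.ofReal_one, div_one] at this
  exact this

theorem fourierCoeff_derivₗ (φ : CircleTest) (n : ℤ) :
    fourierCoeff (derivₗ φ) n = 2 * Real.pi * Complex.I * n * fourierCoeff φ n := by
  rw [fourierCoeff_eq_intervalIntegral _ _ 0, fourierCoeff_eq_intervalIntegral _ _ 0]
  have hφ : ∀ x : ℝ, HasDerivAt (fun y : ℝ => φ (y : UnitAddCircle))
      (derivₗ φ (x : UnitAddCircle)) x := fun x => by
    rw [derivₗ_apply]
    exact (φ.contDiff.differentiable (by simp) x).hasDerivAt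
  have hc : Continuous fun x : ℝ => (fourier (-n) (x : UnitAddCircle) : ℂ) :=
    (fourier (-n)).continuous.comp (AddCircle.continuous_mk' 1)
  have := intervalIntegral.integral_mul_deriv_eq_deriv_mul (a := 0) (b := 0 + 1)
    (u := fun x : ℝ => (fourier (-n) (x : UnitAddCircle) : ℂ))
    (fun x _ => hasDerivAt_fourier_neg 1 n x) (fun x _ => hφ x)
    ((continuous_const.mul hc).intervalIntegrable _ _)
    ((derivₗ φ).contDiff.continuous.intervalIntegrable _ _)
  simp only [smul_eq_mul]
  rw [this, zero_add]
  have h1 : ((1 : ℝ) : UnitAddCircle) = ((0 : ℝ) : UnitAddCircle) := by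
    rw [AddCircle.coe_period]
    rfl
  simp only [h1, sub_self, zero_sub, mul_assoc, intervalIntegral.integral_const_mul]
  simp
  ring

/-- Two derivatives give decay of order `n⁻²`, because the coefficients of the second derivative are
bounded. -/
theorem summable_fourierCoeff (φ : CircleTest) : Summable (fourierCoeff φ) := by
  obtain ⟨C, hC⟩ := (isCompact_range (derivₗ (derivₗ φ)).continuous).isBounded.exists_norm_le
  have hb : ∀ n : ℤ, ‖fourierCoeff (derivₗ (derivₗ φ)) n‖ ≤ C := fun n => by
    refine (norm_integral_le_of_norm_le_const (C := C) (ae_of_all _ fun x => ?_)).trans_eq (by simp)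
    rw [norm_smul, fourier_apply, Circle.norm_coe, one_mul]
    exact hC _ (Set.mem_range_self x)
  have hs : Summable fun n : ℤ => C * (1 / (n : ℝ) ^ 2) :=
    (Real.summable_one_div_int_pow.2 one_lt_two).mul_left C
  refine Summable.of_norm_bounded_eventually hs ?_
  filter_upwards [(Set.finite_singleton (0 : ℤ)).compl_mem_cofinite] with n hn
  have hn0 : (n : ℝ) ≠ 0 := by exact_mod_cast hn
  have h := hb n
  rw [fourierCoeff_derivₗ, fourierCoeff_derivₗ] at h
  simp only [norm_mul, Complex.norm_ofNat, Complex.norm_real, Complex.norm_I, Complex.norm_intCast,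
    Real.norm_eq_abs, abs_of_pos Real.pi_pos] at h
  have h2 : ‖fourierCoeff φ n‖ * (n : ℝ) ^ 2 ≤ C := by
    refine le_trans ?_ h
    rw [← sq_abs (n : ℝ)]
    have h1 : (1 : ℝ) ≤ 2 * Real.pi := by linarith [Real.pi_gt_three]
    have : (1 : ℝ) ≤ (2 * Real.pi) * (2 * Real.pi) := one_le_mul_of_one_le_of_one_le h1 h1
    calc _ = 1 * (‖fourierCoeff φ n‖ * |(n : ℝ)| ^ 2) := (one_mul _).symm
      _ ≤ ((2 * Real.pi) * (2 * Real.pi)) * (‖fourierCoeff φ n‖ * |(n : ℝ)| ^ 2) := by gcongr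
      _ = _ := by ring
  rw [mul_one_div, le_div_iff₀ (by positivity)]
  exact h2

theorem tendstoUniformly_sum (φ : CircleTest) :
    TendstoUniformly (fun (s : Finset ℤ) (x : ℝ) =>
      (∑ n ∈ s, fourierCoeff φ n • circleChar n) (x : UnitAddCircle))
      (fun x : ℝ => φ (x : UnitAddCircle)) atTop := by
  have h : HasSum _ _ := hasSum_fourier_series_of_summable (f := ⟨φ, φ.continuous⟩)
    φ.summable_fourierCoeff
  rw [HasSum, SummationFilter.unconditional_filter, ContinuousMap.tendsto_iff_tendstoUniformly] at h
  convert h.comp ((↑) : ℝ → UnitAddCircle) using 1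
  · ext s x
    simp only [Function.comp_apply, ContinuousMap.sum_apply, sum_apply]
    rfl
  · rfl

/-- The Fourier series of a test function converges to it in the space of test functions. -/
theorem hasSum_fourier (φ : CircleTest) : HasSum (fun n => fourierCoeff φ n • circleChar n) φ := by
  have hcoef : ∀ k n, fourierCoeff ((derivₗ ^ k) φ) n =
      (2 * Real.pi * Complex.I * n) ^ k * fourierCoeff φ n := fun k n => by
    induction k with
    | zero => simp
    | succ k ih => rw [pow_succ', Module.End.mul_apply, fourierCoeff_derivₗ, ih, pow_succ', ← mul_assoc]
  have hchar : ∀ k n, (derivₗ ^ k) (circleChar n) =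
      ((2 * Real.pi * Complex.I * n) ^ k) • circleChar n := fun k n => by
    induction k with
    | zero => simp
    | succ k ih =>
      rw [pow_succ', Module.End.mul_apply, ih, map_smul, derivₗ_circleChar, smul_smul, pow_succ]
  rw [HasSum, SummationFilter.unconditional_filter]
  -- The topology is initial for all derivatives. The `k`-th derivative of a partial sum is the
  -- partial sum for the `k`-th derivative of `φ`, so uniform convergence at order zero suffices.
  simp only [nhds_iInf, nhds_induced, tendsto_iInf, tendsto_comap_iff]
  intro k
  rw [UniformFun.tendsto_iff_tendstoUniformly]
  simp only [Function.comp_def, UniformFun.toFun_ofFun, iteratedDeriv_eq]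
  have := ((derivₗ ^ k) φ).tendstoUniformly_sum
  convert this using 1
  ext s x
  simp only [hcoef, map_sum, map_smul, hchar, smul_smul, mul_comm]

end CircleTest

/-! ### Convolution as a Fourier multiplier on the circle, and Parseval -/

theorem fourierCoeff_of_translate {φ χ : UnitAddCircle → ℂ} {r : UnitAddCircle}
    (h : ∀ x, χ x = φ (x + r)) (n : ℤ) :
    fourierCoeff χ n = fourier n r * fourierCoeff φ n := by
  have := integral_add_right_eq_self (μ := AddCircle.haarAddCircle)
    (fun x : UnitAddCircle => fourier (-n) x • φ x) r
  rw [fourierCoeff, fourierCoeff, ← this, ← integral_const_mul]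
  refine integral_congr_ae (ae_of_all _ fun x => ?_)
  have h1 : (fourier n r : ℂ) * fourier (-n) r = 1 := by
    rw [← fourier_add, add_neg_cancel, fourier_zero]
  have h2 : (fourier (-n) (x + r) : ℂ) = fourier (-n) x * fourier (-n) r := by
    simp only [fourier_apply, smul_add, AddCircle.toCircle_add, Circle.coe_mul]
  simp only [h, smul_eq_mul, h2]
  linear_combination (- fourier (-n) x * φ (x + r)) * h1

theorem IsConvTranspose.hasSum_circle {ε : CircleTest →Lₚₜ[ℂ] ℂ} {φ : CircleTest}
    {f : UnitAddCircle → ℂ} (hf : IsConvTranspose ε φ f) (r : UnitAddCircle) :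
    HasSum (fun n => (fourierCoeff φ n * ε (circleChar n)) * fourier n r) (f r) := by
  obtain ⟨χ, hχ, hr⟩ := hf r
  have := χ.hasSum_fourier.map ε (ContinuousLinearMap.continuous ε)
  rw [hr]
  convert this using 2 with n
  rw [Function.comp_apply, map_smul, fourierCoeff_of_translate hχ, smul_eq_mul]
  ring

/-- The transpose of the convolution operator is a Fourier multiplier. -/
theorem IsConvTranspose.exists_continuousMap {ε : CircleTest →Lₚₜ[ℂ] ℂ} {φ : CircleTest}
    {f : UnitAddCircle → ℂ} (hf : IsConvTranspose ε φ f) :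
    ∃ F : C(UnitAddCircle, ℂ), f = F ∧
      HasSum (fun n => (fourierCoeff φ n * ε (circleChar n)) • fourier n) F := by
  -- At `r = 0` all characters equal `1`, and unconditional convergence in `ℂ` is absolute; no
  -- growth bound on the coefficients of `ε` is needed.
  have hs : Summable fun n => ‖fourierCoeff φ n * ε (circleChar n)‖ := by
    have := (hf.hasSum_circle 0).summable.norm
    simpa using this
  have hF : Summable fun n : ℤ => (fourierCoeff φ n * ε (circleChar n)) •
      (fourier n : C(UnitAddCircle, ℂ)) := by
    refine Summable.of_norm ?_
    simpa only [norm_smul, fourier_norm, mul_one] using hs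
  refine ⟨_, funext fun r => ?_, hF.hasSum⟩
  have := (ContinuousMap.evalCLM ℂ r).hasSum hF.hasSum
  refine (hf.hasSum_circle r).unique (this.congr_fun fun n => ?_)
  simp

/-- By Pythagoras the finite partial sums already have equal norms; pass to the limit. -/
theorem norm_eq_of_hasSum_orthonormal {ι H : Type*} [NormedAddCommGroup H] [InnerProductSpace ℂ H]
    {v : ι → H} (hv : Orthonormal ℂ v) {c d : ι → ℂ} (hcd : ∀ i, ‖c i‖ = ‖d i‖) {x y : H}
    (hx : HasSum (fun i => c i • v i) x) (hy : HasSum (fun i => d i • v i) y) : ‖x‖ = ‖y‖ := by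
  refine tendsto_nhds_unique hx.norm (hy.norm.congr fun s => ?_)
  rw [← sq_eq_sq₀ (norm_nonneg _) (norm_nonneg _), ← inner_self_eq_norm_sq (𝕜 := ℂ),
    ← inner_self_eq_norm_sq (𝕜 := ℂ), hv.inner_sum, hv.inner_sum]
  simp only [RCLike.conj_mul, hcd]

theorem eLpNorm_eq_of_circleFourier {ε₁ ε₂ : CircleTest →Lₚₜ[ℂ] ℂ}
    (h : ∀ n : ℤ, ‖circleFourier ε₁ n‖ = ‖circleFourier ε₂ n‖) {φ : CircleTest}
    {f₁ f₂ : UnitAddCircle → ℂ} (hf₁ : IsConvTranspose ε₁ φ f₁) (hf₂ : IsConvTranspose ε₂ φ f₂) :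
    eLpNorm f₁ 2 volume = eLpNorm f₂ 2 volume := by
  obtain ⟨F₁, rfl, h₁⟩ := hf₁.exists_continuousMap
  obtain ⟨F₂, rfl, h₂⟩ := hf₂.exists_continuousMap
  have hL₁ := (ContinuousMap.toLp (E := ℂ) 2 AddCircle.haarAddCircle ℂ).hasSum h₁
  have hL₂ := (ContinuousMap.toLp (E := ℂ) 2 AddCircle.haarAddCircle ℂ).hasSum h₂
  simp only [map_smul] at hL₁ hL₂
  have hn := norm_eq_of_hasSum_orthonormal (orthonormal_fourier (T := 1)) (fun n => ?_) hL₁ hL₂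
  · have hv : (volume : Measure UnitAddCircle) = AddCircle.haarAddCircle := by
      rw [AddCircle.volume_eq_smul_haarAddCircle]
      simp
    rw [Lp.norm_def, Lp.norm_def, ENNReal.toReal_eq_toReal_iff' (Lp.eLpNorm_ne_top _)
      (Lp.eLpNorm_ne_top _), eLpNorm_congr_ae (ContinuousMap.coeFn_toLp _ F₁),
      eLpNorm_congr_ae (ContinuousMap.coeFn_toLp _ F₂)] at hn
    rw [hv]
    exact hn
  -- The coefficient of index `-n` pairs `ε` with the character of index `n`.
  · have := h (-n)
    simp only [circleFourier, neg_neg] at this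
    rw [norm_mul, norm_mul, this]

end PulseCompression

theorem theorem3p2 {Ω : Type*} [MeasurableSpace Ω] (P : MeasureTheory.Measure Ω)
    [MeasureTheory.IsProbabilityMeasure P] (V : Ω → ℝ) :
    -- the model on the line, with tempered distributions
    (∀ (μ ξ₁ ξ₂ z₁ z₂ : Ω → 𝓢'(ℝ, ℂ)) (ε₁ ε₂ : 𝓢'(ℝ, ℂ)),
      PulseCompression.IsScatterer (G := ℝ) P V μ →
      PulseCompression.IsMeasurement (G := ℝ) P V μ ε₁ ξ₁ z₁ →
      PulseCompression.IsMeasurement (G := ℝ) P V μ ε₂ ξ₂ z₂ →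
      P.map ξ₁ = P.map ξ₂ →
      PulseCompression.SameFourierModulus ε₁ ε₂ →
      P.map z₁ = P.map z₂ ∧
        PulseCompression.posteriorVariance P V z₁
          =ᵐ[P.map z₁] PulseCompression.posteriorVariance P V z₂) ∧
    -- the periodic model, with distributions on the circle
    (∀ (μ ξ₁ ξ₂ z₁ z₂ : Ω → (PulseCompression.CircleTest →Lₚₜ[ℂ] ℂ))
        (ε₁ ε₂ : PulseCompression.CircleTest →Lₚₜ[ℂ] ℂ),
      PulseCompression.IsScatterer (G := UnitAddCircle) P V μ →
      PulseCompression.IsMeasurement (G := UnitAddCircle) P V μ ε₁ ξ₁ z₁ →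
      PulseCompression.IsMeasurement (G := UnitAddCircle) P V μ ε₂ ξ₂ z₂ →
      P.map ξ₁ = P.map ξ₂ →
      (∀ n : ℤ, ‖PulseCompression.circleFourier ε₁ n‖ = ‖PulseCompression.circleFourier ε₂ n‖) →
      P.map z₁ = P.map z₂ ∧
        PulseCompression.posteriorVariance P V z₁
          =ᵐ[P.map z₁] PulseCompression.posteriorVariance P V z₂) := by
  refine ⟨fun μ ξ₁ ξ₂ z₁ z₂ ε₁ ε₂ hS hM₁ hM₂ hξ hε => ?_,
    fun μ ξ₁ ξ₂ z₁ z₂ ε₁ ε₂ hS hM₁ hM₂ hξ hε => ?_⟩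
  · refine PulseCompression.law_and_posteriorVariance_eq (fun ψ => ψ.memLp 2) hS hM₁ hM₂ hξ
      (fun φ f hf => ?_) (fun φ f hf => ?_) fun φ f₁ f₂ hf₁ hf₂ => hε.eLpNorm_eq hf₁ hf₂
    all_goals obtain ⟨e₁, e₂, he₁, he₂, -⟩ := hε
    · exact (hf.continuous_of_hasFourierFunction he₁).aestronglyMeasurable
    · exact (hf.continuous_of_hasFourierFunction he₂).aestronglyMeasurable
  · refine PulseCompression.law_and_posteriorVariance_eq (fun ψ => ψ.memLp) hS hM₁ hM₂ hξ
      (fun φ f hf => ?_) (fun φ f hf => ?_)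
      fun φ f₁ f₂ hf₁ hf₂ _ _ => PulseCompression.eLpNorm_eq_of_circleFourier hε hf₁ hf₂
    all_goals
      obtain ⟨F, rfl, -⟩ := hf.exists_continuousMap
      exact F.continuous.aestronglyMeasurable
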